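/- Let $\Gamma$ be a weighted digraph without loops on a finite vertex set $\{1,\dots,n\}$, with arc weights $w_{ij}>0$ ($w_{ij}=0$ iff there is no arc from $i$ to $j$). Its Laplacian matrix is $L=(\ell_{ij})$ with $\ell_{ij}=-w_{ij}$ for $j\neq i$ and $\ell_{ii}=\sum_{k\neq i}w_{ik}$. A converging tree is a weakly connected digraph in which one vertex, the root, has outdegree $0$ and all other vertices have outdegree $1$; the tree is said to converge to its root. An in-forest of $\Gamma$ is a spanning subgraph of $\Gamma$ all of whose weak components are converging trees. The weight of a subgraph is the product of the weights of its arcs ($1$ if it has no arcs), and the weight of a finite set of subgraphs is the sum of their weights ($0$ for the empty set). For $k=0,1,\dots$ let $\sigma_k$ be the weight of the set of all in-forests of $\Gamma$ with $k$ arcs, and let $Q_k$ be the $n\times n$ matrix whose $(i,j)$ entry is the weight of the set of in-forests with $k$ arcs in which $i$ belongs to a tree converging to $j$. Let $d$ be the minimum number of trees in an in-forest of $\Gamma$, and let $Q(\tau)=\sum_{k=0}^{n-d}Q_k\tau^k$ for $\tau\in\mathbb{R}$. Then $$Q_k=\sum_{i=0}^{k}\sigma_{k-i}(-L)^i,\qquad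 k=0,1,\dots.$$ Consequently, each matrix $Q_k$, $k=0,1,\dots$, commutes with every (real or complex) $n\times n$ matrix that commutes with $L$; in particular, the $Q_k$ commute with $L$, with $Q(\tau)$ for every real $\tau$, and with each other. -/

import Mathlib

noncomputable section

/-- A finite weighted digraph without loops, given by its matrix of arc weights: there is an arc
from `i` to `j` exactly when `weight i j ≠ 0`, and the weights of all arcs are strictly positive. -/
structure WeightedDigraph (V : Type*) where
  weight : V → V → ℝ
  weight_nonneg : ∀ i j, 0 ≤ weight i j
  weight_self : ∀ i, weight i i = 0

/-! Digraphs with vertex set `V` are given by their sets of arcs `(i, j)` (from `i` to `j`). -/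
namespace ArcSet

variable {V : Type*}

/-- The undirected graph that corresponds to a digraph. -/
def weakGraph (F : Finset (V × V)) : SimpleGraph V :=
  SimpleGraph.fromRel (fun i j => (i, j) ∈ F)

/-- The weak components of a digraph. -/
abbrev WeakComponent (F : Finset (V × V)) : Type _ := (weakGraph F).ConnectedComponent

/-- The number of arcs that come from `v`. -/
def outDegree [DecidableEq V] (F : Finset (V × V)) (v : V) : ℕ :=
  (F.filter (fun e => e.1 = v)).card

/-- The weak component `C` of `F` is a converging tree with root `r`: the vertex `r` of `C` has
outdegree zero and the remaining vertices of `C` have outdegree one. (A weak component is weakly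
connected, and all arcs that come from its vertices belong to it, so outdegrees in `C` and in `F`
are the same.) -/
def IsConvergingTree [DecidableEq V] (F : Finset (V × V)) (C : WeakComponent F) (r : V) : Prop :=
  r ∈ C.supp ∧ outDegree F r = 0 ∧ ∀ v ∈ C.supp, v ≠ r → outDegree F v = 1

/-- All weak components are converging trees. -/
def IsConvergingForest [DecidableEq V] (F : Finset (V × V)) : Prop :=
  ∀ C : WeakComponent F, ∃ r, IsConvergingTree F C r

/-- Vertex `i` belongs to a tree converging to `j`. -/
def ConvergesTo [DecidableEq V] (F : Finset (V × V)) (i j : V) : Prop :=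
  IsConvergingTree F ((weakGraph F).connectedComponentMk i) j

end ArcSet

namespace WeightedDigraph

variable {V : Type*} [Fintype V] [DecidableEq V] (Γ : WeightedDigraph V)

/-- The set of arcs. -/
def arcs : Finset (V × V) := Finset.univ.filter (fun e => Γ.weight e.1 e.2 ≠ 0)

/-- The weight of a spanning subgraph: the product of the weights of its arcs. -/
def subgraphWeight (F : Finset (V × V)) : ℝ := ∏ e ∈ F, Γ.weight e.1 e.2

/-- The weight of a set of spanning subgraphs. -/
def setWeight (S : Finset (Finset (V × V))) : ℝ := ∑ F ∈ S, Γ.subgraphWeight F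

open scoped Classical in
/-- The in-forests of `Γ`: its spanning subgraphs that are converging forests. -/
def inForests : Finset (Finset (V × V)) :=
  Γ.arcs.powerset.filter (fun F => ArcSet.IsConvergingForest F)

/-- The in-forests of `Γ` with `k` arcs. -/
def inForestsWithArcs (k : ℕ) : Finset (Finset (V × V)) :=
  Γ.inForests.filter (fun F => F.card = k)

open scoped Classical in
/-- The in-forests of `Γ` with `k` arcs where `i` belongs to a tree converging to `j`. -/
def inForestsConverging (k : ℕ) (i j : V) : Finset (Finset (V × V)) :=
  (Γ.inForestsWithArcs k).filter (fun F => ArcSet.ConvergesTo F i j)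

/-- `σ_k`, the total weight of the in-forests with `k` arcs. -/
def sigma (k : ℕ) : ℝ := Γ.setWeight (Γ.inForestsWithArcs k)

/-- `Q_k`, the matrix of in-forests with `k` arcs. -/
def forestMatrix (k : ℕ) : Matrix V V ℝ :=
  Matrix.of fun i j => Γ.setWeight (Γ.inForestsConverging k i j)

/-- The in-forest dimension `d`: the minimum number of trees in an in-forest of `Γ`. -/
def inForestDimension : ℕ :=
  sInf {m : ℕ | ∃ F ∈ Γ.inForests, Nat.card (ArcSet.WeakComponent F) = m}

/-- `Q(τ) = ∑_{k=0}^{n-d} Q_k τ^k`. -/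
def parametricForestMatrix (τ : ℝ) : Matrix V V ℝ :=
  ∑ k ∈ Finset.range (Fintype.card V - Γ.inForestDimension + 1), τ ^ k • Γ.forestMatrix k

/-- The (row) Laplacian matrix. -/
def laplacian : Matrix V V ℝ :=
  Matrix.of fun i j =>
    if i = j then ∑ k ∈ Finset.univ.erase i, Γ.weight i k else -Γ.weight i j

end WeightedDigraph

end

/-! Everything follows from the recurrence `Q_{k+1} = σ_{k+1} I - L Q_k` (`forestMatrix_succ`);
iterated from `Q_0 = σ_0 I`, it makes `Q_k` a polynomial in `L`. Up to sign, entry `(i, j)` of `L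
Q_k` sums over forests `F` with `k` arcs and vertices `m` the weight `w(F) w_{im}` times `[m has
root j] - [i has root j]`. If `i` is not a root, then `F = G + (i, p)` with `i` a root of `G`, and
exchanging `p` and `m` cancels the terms in pairs (`sum_rootFlow_not_isSink`). If `i` is a root, the
vertices `m` of its own tree contribute nothing, and the other `m` give each forest `F + (i, m)`
with `k + 1` arcs where `i` is not a root exactly once (`sum_not_isSink`). -/

noncomputable section

/-! ### Directed reachability and roots -/

namespace ArcSet

variable {V : Type*}

/-- There is a directed path from `a` to `b`. -/
def Reach (F : Finset (V × V)) (a b : V) : Prop :=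
  Relation.ReflTransGen (fun x y => (x, y) ∈ F) a b

/-- No arc comes from `v`. -/
def IsSink (F : Finset (V × V)) (v : V) : Prop := ∀ b, (v, b) ∉ F

/-- At most one arc comes from each vertex. -/
def IsFunctional (F : Finset (V × V)) : Prop :=
  ∀ ⦃a b c : V⦄, (a, b) ∈ F → (a, c) ∈ F → b = c

/-- `r` is a sink that can be reached from `v`. -/
def HasRoot (F : Finset (V × V)) (v r : V) : Prop := Reach F v r ∧ IsSink F r

theorem Reach.mono {F G : Finset (V × V)} (h : F ⊆ G) {a b : V} (hab : Reach F a b) :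
    Reach G a b :=
  Relation.ReflTransGen.mono (fun _ _ hxy => h hxy) a b hab

theorem Reach.eq_of_isSink {F : Finset (V × V)} {a b : V} (h : Reach F a b) (ha : IsSink F a) :
    a = b := by
  rcases Relation.ReflTransGen.cases_head h with h | ⟨c, hc, -⟩
  · exact h
  · exact absurd hc (ha c)

theorem IsSink.hasRoot {F : Finset (V × V)} {a : V} (ha : IsSink F a) : HasRoot F a a :=
  ⟨Relation.ReflTransGen.refl, ha⟩

theorem HasRoot.head {F : Finset (V × V)} {a b r : V} (hab : (a, b) ∈ F) (h : HasRoot F b r) :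
    HasRoot F a r :=
  ⟨Relation.ReflTransGen.head hab h.1, h.2⟩

theorem HasRoot.of_reach {F : Finset (V × V)} {a b r : V} (hab : Reach F a b)
    (h : HasRoot F b r) : HasRoot F a r :=
  ⟨Relation.ReflTransGen.trans hab h.1, h.2⟩

theorem HasRoot.tail {F : Finset (V × V)} (hF : IsFunctional F) {a b r : V} (hab : (a, b) ∈ F)
    (h : HasRoot F a r) : HasRoot F b r := by
  rcases Relation.ReflTransGen.cases_head h.1 with h' | ⟨c, hc, hcr⟩
  · subst h'
    exact absurd hab (h.2 b)
  · rw [hF hab hc]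
    exact ⟨hcr, h.2⟩

theorem HasRoot.unique {F : Finset (V × V)} (hF : IsFunctional F) {a r s : V}
    (hr : HasRoot F a r) (hs : HasRoot F a s) : r = s := by
  obtain ⟨har, hsr⟩ := hr
  induction har using Relation.ReflTransGen.head_induction_on with
  | refl => exact hs.1.eq_of_isSink hsr
  | head hac _ ih => exact ih (hs.tail hF hac)

theorem weakGraph_adj {F : Finset (V × V)} {a b : V} :
    (weakGraph F).Adj a b ↔ a ≠ b ∧ ((a, b) ∈ F ∨ (b, a) ∈ F) :=
  SimpleGraph.fromRel_adj _ _ _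

theorem Reach.reachable {F : Finset (V × V)} {a b : V} (h : Reach F a b) :
    (weakGraph F).Reachable a b := by
  induction h with
  | refl => exact SimpleGraph.Reachable.refl _
  | @tail b c _ hbc ih =>
    by_cases hne : b = c
    · exact hne ▸ ih
    · exact ih.trans (SimpleGraph.Adj.reachable (weakGraph_adj.2 ⟨hne, Or.inl hbc⟩))

theorem HasRoot.of_adj {F : Finset (V × V)} (hF : IsFunctional F) {a b r : V}
    (hab : (weakGraph F).Adj a b) (h : HasRoot F a r) : HasRoot F b r := by
  rcases (weakGraph_adj.1 hab).2 with h' | h'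
  · exact h.tail hF h'
  · exact h.head h'

theorem HasRoot.of_reachable {F : Finset (V × V)} (hF : IsFunctional F) {a b r : V}
    (hab : (weakGraph F).Reachable a b) (h : HasRoot F a r) : HasRoot F b r := by
  obtain ⟨p⟩ := hab
  induction p with
  | nil => exact h
  | cons hadj _ ih => exact ih (h.of_adj hF hadj)

open scoped Classical in
/-- The sink reached from `v`, and `v` itself if there is none. -/
def root (F : Finset (V × V)) (v : V) : V :=
  if h : ∃ r, HasRoot F v r then h.choose else v

variable [DecidableEq V]

theorem outDegree_eq_zero_iff {F : Finset (V × V)} {v : V} : outDegree F v = 0 ↔ IsSink F v := by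
  simp only [outDegree, Finset.card_eq_zero, Finset.filter_eq_empty_iff, IsSink]
  exact ⟨fun h b hb => h hb rfl, fun h e he hev => h e.2 (by subst hev; exact he)⟩

theorem outDegree_le_one_iff {F : Finset (V × V)} {v : V} :
    outDegree F v ≤ 1 ↔ ∀ b c, (v, b) ∈ F → (v, c) ∈ F → b = c := by
  simp only [outDegree, Finset.card_le_one, Finset.mem_filter]
  constructor
  · intro h b c hb hc
    exact congrArg Prod.snd (h (v, b) ⟨hb, rfl⟩ (v, c) ⟨hc, rfl⟩)
  · rintro h ⟨a, b⟩ ⟨hb, rfl⟩ ⟨a', c⟩ ⟨hc, rfl⟩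
    rw [h b c hb hc]

theorem IsConvergingForest.isFunctional {F : Finset (V × V)} (h : IsConvergingForest F) :
    IsFunctional F := by
  intro a b c
  obtain ⟨r, -, hr0, hr⟩ := h ((weakGraph F).connectedComponentMk a)
  refine outDegree_le_one_iff.1 ?_ b c
  by_cases har : a = r
  · rw [har, hr0]
    exact zero_le_one
  · exact (hr a rfl har).le

theorem IsConvergingForest.hasRoot_of_convergesTo {F : Finset (V × V)}
    (h : IsConvergingForest F) {i j : V} (hij : ConvergesTo F i j) : HasRoot F i j := by
  obtain ⟨hj, hj0, -⟩ := hij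
  exact HasRoot.of_reachable h.isFunctional (SimpleGraph.ConnectedComponent.exact hj)
    (outDegree_eq_zero_iff.1 hj0).hasRoot

theorem convergesTo_of_hasRoot {F : Finset (V × V)} (hF : IsFunctional F) {i j : V}
    (hij : HasRoot F i j) : ConvergesTo F i j := by
  refine ⟨SimpleGraph.ConnectedComponent.sound hij.1.reachable.symm,
    outDegree_eq_zero_iff.2 hij.2, fun v hv hvj => ?_⟩
  refine le_antisymm (outDegree_le_one_iff.2 fun b c hb hc => hF hb hc)
    (Nat.one_le_iff_ne_zero.2 fun h0 => hvj ?_)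
  have hiv : (weakGraph F).Reachable v i := SimpleGraph.ConnectedComponent.exact hv
  exact (outDegree_eq_zero_iff.1 h0).hasRoot.unique hF (hij.of_reachable hF hiv.symm)

/-- Trades weak components for directed paths: in a functional digraph both ends of an arc have the
same roots, so a root is shared by a whole weak component. -/
theorem isConvergingForest_iff {F : Finset (V × V)} :
    IsConvergingForest F ↔ IsFunctional F ∧ ∀ v, ∃ r, HasRoot F v r := by
  constructor
  · intro h
    refine ⟨h.isFunctional, fun v => ?_⟩
    obtain ⟨r, hr⟩ := h ((weakGraph F).connectedComponentMk v)
    exact ⟨r, h.hasRoot_of_convergesTo hr⟩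
  · rintro ⟨hF, hroot⟩ C
    induction C using SimpleGraph.ConnectedComponent.ind with
    | h v =>
      obtain ⟨r, hr⟩ := hroot v
      exact ⟨r, convergesTo_of_hasRoot hF hr⟩

theorem IsConvergingForest.convergesTo_iff {F : Finset (V × V)} (h : IsConvergingForest F)
    {i j : V} : ConvergesTo F i j ↔ HasRoot F i j :=
  ⟨h.hasRoot_of_convergesTo, convergesTo_of_hasRoot h.isFunctional⟩

theorem IsConvergingForest.hasRoot_root {F : Finset (V × V)} (h : IsConvergingForest F) (v : V) :
    HasRoot F v (root F v) := by
  have hv := (isConvergingForest_iff.1 h).2 v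
  rw [root, dif_pos hv]
  exact hv.choose_spec

theorem IsConvergingForest.root_eq_iff {F : Finset (V × V)} (h : IsConvergingForest F) {v r : V} :
    root F v = r ↔ HasRoot F v r :=
  ⟨fun hr => hr ▸ h.hasRoot_root v, (h.hasRoot_root v).unique h.isFunctional⟩

theorem IsConvergingForest.root_eq_self {F : Finset (V × V)} (h : IsConvergingForest F) {v : V}
    (hv : IsSink F v) : root F v = v :=
  h.root_eq_iff.2 hv.hasRoot

/-! ### Adding and deleting an arc -/

theorem HasRoot.insert_of_ne {F : Finset (V × V)} {i m v r : V} (h : HasRoot F v r)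
    (hr : r ≠ i) : HasRoot (insert (i, m) F) v r := by
  refine ⟨h.1.mono (Finset.subset_insert _ _), fun b hb => ?_⟩
  rcases Finset.mem_insert.1 hb with hb | hb
  · exact hr (congrArg Prod.fst hb)
  · exact h.2 b hb

theorem HasRoot.insert_of_eq {F : Finset (V × V)} {i m v r : V} (h : HasRoot F v i)
    (hm : HasRoot F m r) (hr : r ≠ i) : HasRoot (insert (i, m) F) v r :=
  HasRoot.of_reach (h.1.mono (Finset.subset_insert _ _))
    ((hm.insert_of_ne hr).head (Finset.mem_insert_self _ _))

/-- The new arc hangs the tree of `i` onto a different tree, so it closes no cycle. -/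
theorem IsConvergingForest.insert {F : Finset (V × V)} (h : IsConvergingForest F) {i m : V}
    (hi : IsSink F i) (hm : root F m ≠ i) : IsConvergingForest (insert (i, m) F) := by
  refine isConvergingForest_iff.2 ⟨fun a b c hb hc => ?_, fun v => ?_⟩
  · simp only [Finset.mem_insert, Prod.mk.injEq] at hb hc
    rcases hb with ⟨rfl, rfl⟩ | hb <;> rcases hc with ⟨h1, rfl⟩ | hc
    · rfl
    · exact absurd hc (hi c)
    · subst h1
      exact absurd hb (hi b)
    · exact h.isFunctional hb hc
  · by_cases hv : root F v = i
    · exact ⟨_, (h.root_eq_iff.1 hv).insert_of_eq (h.hasRoot_root m) hm⟩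
    · exact ⟨_, (h.hasRoot_root v).insert_of_ne hv⟩

theorem IsConvergingForest.root_insert {F : Finset (V × V)} (h : IsConvergingForest F) {i m : V}
    (hi : IsSink F i) (hm : root F m ≠ i) (v : V) :
    root (Insert.insert (i, m) F) v = if root F v = i then root F m else root F v := by
  rw [(h.insert hi hm).root_eq_iff]
  split_ifs with hv
  · exact (h.root_eq_iff.1 hv).insert_of_eq (h.hasRoot_root m) hm
  · exact (h.hasRoot_root v).insert_of_ne hv

theorem IsFunctional.isSink_erase {F : Finset (V × V)} (hF : IsFunctional F) {i p : V}
    (hip : (i, p) ∈ F) : IsSink (F.erase (i, p)) i := by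
  intro b hb
  obtain ⟨hne, hb⟩ := Finset.mem_erase.1 hb
  exact hne (by rw [hF hb hip])

theorem IsConvergingForest.erase {F : Finset (V × V)} (h : IsConvergingForest F) {i p : V}
    (hip : (i, p) ∈ F) : IsConvergingForest (F.erase (i, p)) := by
  refine isConvergingForest_iff.2 ⟨fun a b c hb hc => h.isFunctional
    (Finset.mem_of_mem_erase hb) (Finset.mem_of_mem_erase hc), fun v => ?_⟩
  obtain ⟨r, hvr, hr⟩ := (isConvergingForest_iff.1 h).2 v
  induction hvr using Relation.ReflTransGen.head_induction_on with
  | refl => exact ⟨r, IsSink.hasRoot fun b hb => hr b (Finset.mem_of_mem_erase hb)⟩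
  | @head a c hac _ ih =>
    by_cases hai : a = i
    · subst hai
      exact ⟨a, (h.isFunctional.isSink_erase hip).hasRoot⟩
    · obtain ⟨s, hs⟩ := ih
      exact ⟨s, hs.head (Finset.mem_erase.2 ⟨fun he => hai (congrArg Prod.fst he), hac⟩)⟩

/-- Otherwise `(i, p)` would lie on a cycle, which no path in a functional digraph can leave to
reach a sink. -/
theorem IsConvergingForest.root_erase_ne {F : Finset (V × V)} (h : IsConvergingForest F)
    {i p : V} (hip : (i, p) ∈ F) : root (F.erase (i, p)) p ≠ i := by
  intro hp
  have hpi : Reach F p i := (((h.erase hip).root_eq_iff.1 hp).1).mono (Finset.erase_subset _ _)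
  obtain ⟨r, hir, hr⟩ := (isConvergingForest_iff.1 h).2 i
  -- Each vertex on the path from `i` can return to `i`: its only arc is `(i, p)` or the next arc of
  -- the way back.
  have hri : Reach F r i := by
    clear hr
    induction hir with
    | refl => exact Relation.ReflTransGen.refl
    | @tail b c _ hbc ih =>
      rcases Relation.ReflTransGen.cases_head ih with hb | ⟨c', hc', hci⟩
      · subst hb
        rwa [h.isFunctional hbc hip]
      · rwa [h.isFunctional hbc hc']
  have := hri.eq_of_isSink hr
  subst this
  exact hr p hip

end ArcSet

/-! ### Weighted sums over forests -/

namespace WeightedDigraph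

open ArcSet

variable {V : Type*} [Fintype V] [DecidableEq V] (Γ : WeightedDigraph V)

open scoped Classical in
/-- The converging forests with `k` arcs on the vertex set `V`. -/
def forests (V : Type*) [Fintype V] [DecidableEq V] (k : ℕ) : Finset (Finset (V × V)) :=
  Finset.univ.filter fun F => IsConvergingForest F ∧ F.card = k

theorem mem_forests {k : ℕ} {F : Finset (V × V)} :
    F ∈ forests V k ↔ IsConvergingForest F ∧ F.card = k := by
  simp [forests]

omit [DecidableEq V] in
theorem subgraphWeight_eq_zero {F : Finset (V × V)} (h : ¬ F ⊆ Γ.arcs) :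
    Γ.subgraphWeight F = 0 := by
  obtain ⟨e, he, hea⟩ := Finset.not_subset.1 h
  refine Finset.prod_eq_zero he ?_
  simpa [arcs] using hea

theorem inForestsWithArcs_eq (k : ℕ) :
    Γ.inForestsWithArcs k = (forests V k).filter fun F => F ⊆ Γ.arcs := by
  ext F
  simp only [inForestsWithArcs, inForests, Finset.mem_filter, Finset.mem_powerset, mem_forests]
  tauto

/-- Forests that use a non-arc weigh zero, so the bijections below need not refer to the arcs of
`Γ`. -/
theorem sum_inForestsWithArcs (k : ℕ) (φ : Finset (V × V) → ℝ) :
    ∑ F ∈ Γ.inForestsWithArcs k, Γ.subgraphWeight F * φ F =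
      ∑ F ∈ forests V k, Γ.subgraphWeight F * φ F := by
  rw [inForestsWithArcs_eq]
  refine Finset.sum_subset (Finset.filter_subset _ _) fun F hF hF' => ?_
  rw [Γ.subgraphWeight_eq_zero fun h => hF' (Finset.mem_filter.2 ⟨hF, h⟩), zero_mul]

theorem sigma_eq (k : ℕ) : Γ.sigma k = ∑ F ∈ forests V k, Γ.subgraphWeight F := by
  simpa [sigma, setWeight] using Γ.sum_inForestsWithArcs k fun _ => 1

theorem forestMatrix_apply (k : ℕ) (i j : V) :
    Γ.forestMatrix k i j =
      ∑ F ∈ forests V k, Γ.subgraphWeight F * (if root F i = j then 1 else 0) := by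
  rw [← sum_inForestsWithArcs, forestMatrix, Matrix.of_apply, setWeight, inForestsConverging,
    Finset.sum_filter]
  refine Finset.sum_congr rfl fun F hF => ?_
  rw [inForestsWithArcs_eq, Finset.mem_filter, mem_forests] at hF
  simp only [hF.1.1.convergesTo_iff, ← hF.1.1.root_eq_iff, mul_ite, mul_one, mul_zero]

open scoped Classical in
/-- The converging forests with `k` arcs where `i` is a root. -/
def rootedForests (k : ℕ) (i : V) : Finset (Finset (V × V)) :=
  (forests V k).filter fun F => IsSink F i

open scoped Classical in
theorem sum_forests_split (k : ℕ) (i : V) (φ : Finset (V × V) → ℝ) :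
    ∑ F ∈ forests V k, φ F =
      ∑ F ∈ rootedForests k i, φ F + ∑ F ∈ forests V k with ¬ IsSink F i, φ F :=
  (Finset.sum_filter_add_sum_filter_not _ _ _).symm

open scoped Classical in
/-- The forests where `i` is not a root arise by adding an arc from `i`, to a vertex of another
tree, to the forests where `i` is a root. -/
theorem sum_not_isSink (k : ℕ) (i : V) (φ : Finset (V × V) → ℝ) :
    ∑ F ∈ forests V (k + 1) with ¬ IsSink F i, φ F =
      ∑ G ∈ rootedForests k i, ∑ m with root G m ≠ i, φ (insert (i, m) G) := by
  rw [Finset.sum_sigma']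
  symm
  refine Finset.sum_bij (fun x _ => insert (i, x.2) x.1) ?_ ?_ ?_ fun _ _ => rfl
  · rintro ⟨G, m⟩ h
    simp only [rootedForests, Finset.mem_sigma, Finset.mem_filter, mem_forests, Finset.mem_univ,
      true_and] at h ⊢
    obtain ⟨⟨⟨hG, hk⟩, hi⟩, hm⟩ := h
    refine ⟨⟨hG.insert hi hm, ?_⟩, fun hs => hs m (Finset.mem_insert_self _ _)⟩
    rw [Finset.card_insert_of_notMem (hi m), hk]
  · rintro ⟨G, m⟩ h ⟨G', m'⟩ h' heq
    simp only [rootedForests, Finset.mem_sigma, Finset.mem_filter, mem_forests, Finset.mem_univ,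
      true_and] at h h' heq
    have hmm : m = m' := by
      have hmem : (i, m) ∈ insert (i, m') G' := heq ▸ Finset.mem_insert_self _ _
      rcases Finset.mem_insert.1 hmem with he | he
      · exact congrArg Prod.snd he
      · exact absurd he (h'.1.2 m)
    subst hmm
    have hGG : G = G' := by
      rw [← Finset.erase_insert (h.1.2 m), heq, Finset.erase_insert (h'.1.2 m)]
    rw [hGG]
  · intro F hF
    simp only [Finset.mem_filter, mem_forests, IsSink, not_forall, not_not] at hF
    obtain ⟨⟨hF, hk⟩, p, hp⟩ := hF
    refine ⟨⟨F.erase (i, p), p⟩, ?_, Finset.insert_erase hp⟩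
    simp only [rootedForests, Finset.mem_sigma, Finset.mem_filter, mem_forests, Finset.mem_univ,
      true_and]
    refine ⟨⟨⟨hF.erase hp, ?_⟩, hF.isFunctional.isSink_erase hp⟩, hF.root_erase_ne hp⟩
    rw [Finset.card_erase_of_mem hp, hk, Nat.add_sub_cancel]

omit [Fintype V] in
theorem subgraphWeight_insert {G : Finset (V × V)} {i : V} (hi : IsSink G i) (m : V) :
    Γ.subgraphWeight (insert (i, m) G) = Γ.weight i m * Γ.subgraphWeight G :=
  Finset.prod_insert (hi m)

theorem mem_rootedForests {k : ℕ} {i : V} {G : Finset (V × V)} :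
    G ∈ rootedForests k i ↔ (IsConvergingForest G ∧ G.card = k) ∧ IsSink G i := by
  simp only [rootedForests, Finset.mem_filter, mem_forests]

/-! ### Cancellation and the recurrence -/

/-- The outflow from `i` of the indicator function of the trees with root `j`. -/
def rootFlow (F : Finset (V × V)) (i j : V) : ℝ :=
  ∑ m, Γ.weight i m * ((if root F m = j then 1 else 0) - if root F i = j then 1 else 0)

open scoped Classical in
theorem sum_rootFlow_not_isSink (k : ℕ) (i j : V) :
    ∑ F ∈ forests V k with ¬ IsSink F i, Γ.subgraphWeight F * Γ.rootFlow F i j = 0 := by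
  cases k with
  | zero =>
    refine Finset.sum_eq_zero fun F hF => absurd ?_ (Finset.mem_filter.1 hF).2
    rw [Finset.card_eq_zero.1 (mem_forests.1 (Finset.mem_filter.1 hF).1).2]
    exact fun b => Finset.notMem_empty _
  | succ k =>
    rw [sum_not_isSink]
    refine Finset.sum_eq_zero fun G hG => ?_
    obtain ⟨⟨hG, -⟩, hi⟩ := mem_rootedForests.1 hG
    set S : Finset V := Finset.univ.filter fun m => root G m ≠ i
    set g : V → ℝ := fun m => if root G m = j then 1 else 0
    have hterm : ∀ p ∈ S, Γ.subgraphWeight (insert (i, p) G) * Γ.rootFlow (insert (i, p) G) i j =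
        Γ.subgraphWeight G * ∑ m ∈ S, Γ.weight i p * Γ.weight i m * (g m - g p) := by
      intro p hp
      have hp' : root G p ≠ i := (Finset.mem_filter.1 hp).2
      have hflow : Γ.rootFlow (insert (i, p) G) i j = ∑ m ∈ S, Γ.weight i m * (g m - g p) := by
        rw [rootFlow, Finset.sum_filter]
        refine Finset.sum_congr rfl fun m _ => ?_
        -- After adding `(i, p)`, the old tree of `i` has the root of `p`, so its vertices `m` drop
        -- out.
        rw [hG.root_insert hi hp' m, hG.root_insert hi hp' i, if_pos (hG.root_eq_self hi)]
        by_cases hm : root G m = i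
        · simp [hm]
        · rw [if_neg hm, if_pos hm]
      rw [hflow, Γ.subgraphWeight_insert hi, Finset.mul_sum, Finset.mul_sum]
      exact Finset.sum_congr rfl fun m _ => by ring
    rw [Finset.sum_congr rfl hterm, ← Finset.mul_sum]
    have hanti : ∑ p ∈ S, ∑ m ∈ S, Γ.weight i p * Γ.weight i m * (g m - g p) =
        -∑ p ∈ S, ∑ m ∈ S, Γ.weight i p * Γ.weight i m * (g m - g p) := by
      conv_lhs => rw [Finset.sum_comm]
      simp only [← Finset.sum_neg_distrib]
      exact Finset.sum_congr rfl fun p _ => Finset.sum_congr rfl fun m _ => by ring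
    rw [self_eq_neg.1 hanti, mul_zero]

/-- Only forests with root `i` survive on the left and only those where `i` is not a root on the
right; adding an arc from `i` matches them. -/
theorem sum_rootFlow (k : ℕ) (i j : V) :
    ∑ F ∈ forests V k, Γ.subgraphWeight F * Γ.rootFlow F i j =
      ∑ F ∈ forests V (k + 1), Γ.subgraphWeight F *
        ((if root F i = j then 1 else 0) - if i = j then 1 else 0) := by
  classical
  rw [sum_forests_split k i, sum_rootFlow_not_isSink, add_zero, sum_forests_split (k + 1) i,
    sum_not_isSink, Finset.sum_eq_zero (s := rootedForests (k + 1) i), zero_add]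
  · refine Finset.sum_congr rfl fun G hG => ?_
    obtain ⟨⟨hG, -⟩, hi⟩ := mem_rootedForests.1 hG
    rw [rootFlow, Finset.mul_sum, Finset.sum_filter]
    refine Finset.sum_congr rfl fun m _ => ?_
    rw [hG.root_eq_self hi]
    by_cases hm : root G m = i
    · simp [hm]
    · rw [if_pos hm, Γ.subgraphWeight_insert hi, hG.root_insert hi hm,
        if_pos (hG.root_eq_self hi)]
      ring
  · intro F hF
    obtain ⟨⟨hF, -⟩, hi⟩ := mem_rootedForests.1 hF
    rw [hF.root_eq_self hi, sub_self, mul_zero]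

theorem laplacian_mul_apply (M : Matrix V V ℝ) (i j : V) :
    (Γ.laplacian * M) i j = ∑ m, Γ.weight i m * (M i j - M m j) := by
  have hoff : ∀ m ∈ Finset.univ.erase i, Γ.laplacian i m * M m j = -(Γ.weight i m * M m j) := by
    intro m hm
    rw [laplacian, Matrix.of_apply, if_neg (Finset.ne_of_mem_erase hm).symm, neg_mul]
  rw [Matrix.mul_apply, ← Finset.add_sum_erase _ _ (Finset.mem_univ i), Finset.sum_congr rfl hoff,
    ← Finset.add_sum_erase _ (fun m => Γ.weight i m * (M i j - M m j)) (Finset.mem_univ i),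
    laplacian, Matrix.of_apply, if_pos rfl, Γ.weight_self, zero_mul, zero_add, Finset.sum_mul,
    ← Finset.sum_add_distrib]
  exact Finset.sum_congr rfl fun m _ => by ring

theorem forestMatrix_succ (k : ℕ) :
    Γ.forestMatrix (k + 1) = Γ.sigma (k + 1) • 1 - Γ.laplacian * Γ.forestMatrix k := by
  ext i j
  have hflow : (Γ.laplacian * Γ.forestMatrix k) i j =
      -∑ F ∈ forests V k, Γ.subgraphWeight F * Γ.rootFlow F i j := by
    simp only [laplacian_mul_apply, forestMatrix_apply, rootFlow, Finset.mul_sum,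
      ← Finset.sum_sub_distrib, ← Finset.sum_neg_distrib]
    rw [Finset.sum_comm]
    exact Finset.sum_congr rfl fun F _ => Finset.sum_congr rfl fun m _ => by ring
  rw [Matrix.sub_apply, hflow, sum_rootFlow, Matrix.smul_apply, Matrix.one_apply, sigma_eq,
    forestMatrix_apply, smul_eq_mul, Finset.sum_mul, sub_neg_eq_add, ← Finset.sum_add_distrib]
  exact Finset.sum_congr rfl fun F _ => by ring

theorem forests_zero : forests V 0 = {∅} := by
  ext F
  rw [mem_forests, Finset.mem_singleton, Finset.card_eq_zero, and_iff_right_iff_imp]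
  rintro rfl
  exact isConvergingForest_iff.2 ⟨fun _ _ _ h => absurd h (Finset.notMem_empty _),
    fun v => ⟨v, IsSink.hasRoot fun _ => Finset.notMem_empty _⟩⟩

theorem forestMatrix_zero : Γ.forestMatrix 0 = Γ.sigma 0 • 1 := by
  have h : IsConvergingForest (∅ : Finset (V × V)) :=
    (mem_forests.1 (forests_zero (V := V) ▸ Finset.mem_singleton_self _)).1
  ext i j
  rw [forestMatrix_apply, sigma_eq, forests_zero, Finset.sum_singleton, Finset.sum_singleton,
    h.root_eq_self fun _ => Finset.notMem_empty _, Matrix.smul_apply, Matrix.one_apply,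
    smul_eq_mul]

theorem forestMatrix_eq_sum (k : ℕ) :
    Γ.forestMatrix k = ∑ i ∈ Finset.range (k + 1), Γ.sigma (k - i) • (-Γ.laplacian) ^ i := by
  induction k with
  | zero => simp [forestMatrix_zero]
  | succ k ih =>
    -- The split-off term `i = 0` is `σ_{k+1} I`; the shifted rest is `-L` times the sum for `k`.
    rw [forestMatrix_succ, ih, Finset.sum_range_succ' _ (k + 1), sub_eq_neg_add, ← neg_mul,
      Finset.mul_sum,
      Nat.sub_zero, pow_zero]
    congr 1
    refine Finset.sum_congr rfl fun i _ => ?_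
    rw [Nat.add_sub_add_right, pow_succ', Matrix.mul_smul]

/-! ### Commutation of polynomials in the Laplacian -/

theorem commute_forestMatrix {M : Matrix V V ℝ} (k : ℕ) (h : Commute Γ.laplacian M) :
    Commute (Γ.forestMatrix k) M := by
  rw [forestMatrix_eq_sum]
  exact Commute.sum_left _ _ _ fun i _ => (h.neg_left.pow_left i).smul_left _

theorem map_forestMatrix (k : ℕ) :
    (Γ.forestMatrix k).map (algebraMap ℝ ℂ) = ∑ i ∈ Finset.range (k + 1),
      (Γ.sigma (k - i) : ℂ) • (-Γ.laplacian.map (algebraMap ℝ ℂ)) ^ i := by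
  rw [forestMatrix_eq_sum, ← RingHom.mapMatrix_apply, ← RingHom.mapMatrix_apply, map_sum]
  refine Finset.sum_congr rfl fun i _ => ?_
  rw [← map_neg, ← map_pow]
  ext a b
  simp

theorem commute_map_forestMatrix {M : Matrix V V ℂ} (k : ℕ)
    (h : Commute (Γ.laplacian.map (algebraMap ℝ ℂ)) M) :
    Commute ((Γ.forestMatrix k).map (algebraMap ℝ ℂ)) M := by
  rw [map_forestMatrix]
  exact Commute.sum_left _ _ _ fun i _ => (h.neg_left.pow_left i).smul_left _

theorem commute_forestMatrix_forestMatrix (k m : ℕ) :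
    Commute (Γ.forestMatrix k) (Γ.forestMatrix m) :=
  Γ.commute_forestMatrix k (Γ.commute_forestMatrix m (Commute.refl _)).symm

end WeightedDigraph

end

theorem proposition6 {V : Type*} [Fintype V] [DecidableEq V] (Γ : WeightedDigraph V) :
    (∀ k : ℕ, Γ.forestMatrix k =
      ∑ i ∈ Finset.range (k + 1), Γ.sigma (k - i) • (-Γ.laplacian) ^ i) ∧
    (∀ (k : ℕ) (M : Matrix V V ℝ), Commute Γ.laplacian M → Commute (Γ.forestMatrix k) M) ∧
    (∀ (k : ℕ) (M : Matrix V V ℂ), Commute (Γ.laplacian.map (algebraMap ℝ ℂ)) M →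
      Commute ((Γ.forestMatrix k).map (algebraMap ℝ ℂ)) M) ∧
    (∀ k : ℕ, Commute (Γ.forestMatrix k) Γ.laplacian) ∧
    (∀ (k : ℕ) (τ : ℝ), Commute (Γ.forestMatrix k) (Γ.parametricForestMatrix τ)) ∧
    (∀ k m : ℕ, Commute (Γ.forestMatrix k) (Γ.forestMatrix m)) := by
  refine ⟨Γ.forestMatrix_eq_sum, fun k _ h => Γ.commute_forestMatrix k h,
    fun k _ h => Γ.commute_map_forestMatrix k h,
    fun k => Γ.commute_forestMatrix k (Commute.refl _), fun k τ => ?_,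
    Γ.commute_forestMatrix_forestMatrix⟩
  exact Commute.sum_right _ _ _ fun m _ =>
    (Γ.commute_forestMatrix_forestMatrix k m).smul_right _
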